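/- **Setting.** Let $f:\mathcal X\to\mathbb R\cup\{+\infty\}$ and $g:\mathbb R^m\to\mathbb R\cup\{+\infty\}$ be proper, closed and convex, where $\mathcal X$ is $\mathbb R^n$ equipped with a norm $\|\cdot\|_{\mathcal X}$ induced by an inner product (for instance the Euclidean one), let $A:\mathcal X\to\mathbb R^m$ be linear, and let $A^\top$ be its adjoint. Put $P(x)=f(x)+g(Ax)$, $P^\star=\inf_x P(x)$, and $D(y)=-f^*(-A^\top y)-g^*(y)$, where $f^*,g^*$ are the Fenchel conjugates. Let $\mathcal X^\star$ be the set of minimizers of $P$ in $\operatorname{dom}P$ and $\mathcal Y^\star$ the set of maximizers of $D$ in $\operatorname{dom} D=\{D>-\infty\}$. Let $\|y\|_{\mathcal Y}=\|Sy\|$ for a matrix $S$ (a weighted (semi)norm), with dual norm $\|u\|_{\mathcal Y,*}=\sup\{\langle u,v\rangle:\|v\|_{\mathcal Y}\le 1\}$, and let $\bar L_A=\sup_{x\neq0}\|Ax\|_{\mathcal Y,*}^2/\|x\|_{\mathcal X}^2$; assume $0<\bar L_A<\infty$. Let $p:\mathbb R^m\to\mathbb R$ be differentiable and $1$-strongly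 convex with respect to $\|\cdot\|_{\mathcal Y}$ (that is, $p-\frac12\|\cdot\|_{\mathcal Y}^2$ is convex), with $\|\nabla p(z)-\nabla p(z')\|_{\mathcal Y,*}\le L_{b_{\mathcal Y}}\|z-z'\|_{\mathcal Y}$ for all $z,z'$, and let $b_{\mathcal Y}(y,\dot y)=p(y)-p(\dot y)-\langle\nabla p(\dot y),y-\dot y\rangle$. Fix $\dot y\in\mathbb R^m$. **Algorithm (ASGARD).** Given $\beta_1>0$ and $\bar x^0$, set $\tau_0=1$, $\hat x^0=\bar x^0$. For $k=0,1,2,\dots$: let $\tau_{k+1}\in(0,1)$ be the unique positive root of $\tau^3/L_{b_{\mathcal Y}}+\tau^2+\tau_k^2\tau-\tau_k^2=0$; let $$y^k\in\arg\max_{y\in\mathbb R^m}\{\langle A\hat x^k,y\rangle-g^*(y)-\beta_{k+1}b_{\mathcal Y}(y,\dot y)\},\qquad \bar x^{k+1}=\operatorname{prox}_{\beta_{k+1}\bar L_A^{-1}f}\big(\hat x^k-\beta_{k+1}\bar L_A^{-1}A^\top y^k\big),$$ where $\operatorname{prox}_\varphi(z)=\arg\min_u\{\varphi(u)+\frac12\|u-z\|_{\mathcal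 X}^2\}$; and put $$\hat x^{k+1}=\bar x^{k+1}+\frac{\tau_{k+1}(1-\tau_k)}{\tau_k}(\bar x^{k+1}-\bar x^k),\qquad \beta_{k+2}=\frac{\beta_{k+1}}{1+L_{b_{\mathcal Y}}^{-1}\tau_{k+1}}.$$ **Theorem.** Let $(\bar x^k)$ be generated by this algorithm for some $\beta_1>0$, with $L_{b_{\mathcal Y}}=1$. 1. If $\operatorname{dom} g=\mathbb R^m$, then for every $x^\star\in\mathcal X^\star$, every $k\ge1$ and every $y^*(\bar x^k)\in\partial g(A\bar x^k)$, $$P(\bar x^k)-P^\star\le\frac{\bar L_A}{2\beta_1k}\|\bar x^0-x^\star\|_{\mathcal X}^2+\frac{2\beta_1}{k+1}b_{\mathcal Y}(y^*(\bar x^k),\dot y).$$ 2. Let $g=\delta_{\{c\}}$ be the indicator function of $\{c\}$, so that the problem is $f^\star=\inf\{f(x):Ax=c\}=P^\star$, and assume Slater's condition $\operatorname{ri}(\operatorname{dom} f)\cap\{x:Ax=c\}\ne\emptyset$. Then for all $x^\star\in\mathcal X^\star$, $y^\star\in\mathcal Y^\star$ and $k\ge1$, $$f(\bar x^k)-f^\star\ge-\|y^\star\|_{\mathcal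 Y}\|A\bar x^k-c\|_{\mathcal Y,*},$$ $$f(\bar x^k)-f^\star\le\frac1k\frac{\bar L_A}{2\beta_1}\|\bar x^0-x^\star\|_{\mathcal X}^2+\|y^\star\|_{\mathcal Y}\|A\bar x^k-c\|_{\mathcal Y,*}+\frac{2\beta_1}{k+1}b_{\mathcal Y}(y^\star,\dot y),$$ $$\|A\bar x^k-c\|_{\mathcal Y,*}\le\frac{2\beta_1}{k+1}\Big[\|y^\star-\dot y\|_{\mathcal Y}+\big(\|y^\star-\dot y\|_{\mathcal Y}^2+\beta_1^{-2}\bar L_A\|\bar x^0-x^\star\|_{\mathcal X}^2\big)^{1/2}\Big].$$ -/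

import Mathlib

open Set

/-- The effective domain of an extended-real-valued function. -/
def effDom {V : Type*} (φ : V → EReal) : Set V := {v | φ v < ⊤}

/-- `φ : V → ℝ ∪ {+∞}` is proper, closed (lower semicontinuous) and convex (convex epigraph). -/
structure IsProperClosedConvex {V : Type*} [NormedAddCommGroup V] [InnerProductSpace ℝ V]
    (φ : V → EReal) : Prop where
  ne_bot : ∀ v, φ v ≠ ⊥
  proper : (effDom φ).Nonempty
  closed : LowerSemicontinuous φ
  convex : Convex ℝ {q : V × ℝ | φ q.1 ≤ (q.2 : EReal)}

/-- The Fenchel conjugate `φ*(y) = sup_v (⟨v, y⟩ - φ(v))`. -/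
noncomputable def fenchelConj {V : Type*} [NormedAddCommGroup V] [InnerProductSpace ℝ V]
    (φ : V → EReal) (y : V) : EReal :=
  ⨆ v, (((inner ℝ v y : ℝ) : EReal) - φ v)

/-- The subdifferential `∂φ(v)`. -/
def subdiff {V : Type*} [NormedAddCommGroup V] [InnerProductSpace ℝ V]
    (φ : V → EReal) (v : V) : Set V :=
  {y | v ∈ effDom φ ∧ ∀ w, φ v + ((inner ℝ y (w - v) : ℝ) : EReal) ≤ φ w}

open Classical in
/-- The indicator function `δ_C` of convex analysis: `0` on `C`, `+∞` outside `C`. -/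
noncomputable def indicatorFun {V : Type*} (C : Set V) (v : V) : EReal :=
  if v ∈ C then 0 else ⊤

/-- `u` is a value of the proximal operator of `φ` at `z`, i.e. a minimizer of
`φ(v) + (1/2)‖v - z‖²`. -/
def IsProx {V : Type*} [NormedAddCommGroup V] [InnerProductSpace ℝ V]
    (φ : V → EReal) (z u : V) : Prop :=
  ∀ v, φ u + ((1 / 2 * ‖u - z‖ ^ 2 : ℝ) : EReal) ≤ φ v + ((1 / 2 * ‖v - z‖ ^ 2 : ℝ) : EReal)

section Problem

variable {E F : Type*} [NormedAddCommGroup E] [InnerProductSpace ℝ E] [FiniteDimensional ℝ E]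
  [NormedAddCommGroup F] [InnerProductSpace ℝ F] [FiniteDimensional ℝ F]

/-- The primal objective `P(x) = f(x) + g(Ax)`. -/
noncomputable def primalObj (f : E → EReal) (g : F → EReal) (A : E →ₗ[ℝ] F) (x : E) : EReal :=
  f x + g (A x)

/-- The primal optimal value `P⋆ = inf_x P(x)`. -/
noncomputable def primalValue (f : E → EReal) (g : F → EReal) (A : E →ₗ[ℝ] F) : EReal :=
  ⨅ x, primalObj f g A x

/-- The primal solution set `X⋆`. -/
def primalSolutions (f : E → EReal) (g : F → EReal) (A : E →ₗ[ℝ] F) : Set E :=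
  {x | x ∈ effDom (primalObj f g A) ∧ ∀ x', primalObj f g A x ≤ primalObj f g A x'}

/-- The dual objective `D(y) = -f*(-Aᵀy) - g*(y)`. -/
noncomputable def dualObj (f : E → EReal) (g : F → EReal) (A : E →ₗ[ℝ] F) (y : F) : EReal :=
  -fenchelConj f (-(LinearMap.adjoint A y)) - fenchelConj g y

/-- The dual solution set `Y⋆`. -/
def dualSolutions (f : E → EReal) (g : F → EReal) (A : E →ₗ[ℝ] F) : Set F :=
  {y | ⊥ < dualObj f g A y ∧ ∀ y', dualObj f g A y' ≤ dualObj f g A y}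

end Problem

section Weighted

variable {E F G : Type*} [NormedAddCommGroup E] [InnerProductSpace ℝ E] [FiniteDimensional ℝ E]
  [NormedAddCommGroup F] [InnerProductSpace ℝ F] [FiniteDimensional ℝ F]
  [NormedAddCommGroup G] [InnerProductSpace ℝ G] [FiniteDimensional ℝ G]

/-- The (semi)norm `‖y‖_S = ⟨Sy, Sy⟩^{1/2}`. -/
noncomputable def wNorm (S : F →ₗ[ℝ] G) (y : F) : ℝ := ‖S y‖

/-- The dual norm of `‖·‖_S` of a linear functional: `sup {φ(v) : ‖v‖_S ≤ 1}`, in `[0, ∞]`. -/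
noncomputable def wDualNormFun (S : F →ₗ[ℝ] G) (φ : F →L[ℝ] ℝ) : ENNReal :=
  ⨆ (v : F) (_ : wNorm S v ≤ 1), ENNReal.ofReal (φ v)

/-- The dual norm of a vector: `‖u‖_{S,*} = sup {⟨u, v⟩ : ‖v‖_S ≤ 1}`, in `[0, ∞]`. -/
noncomputable def wDualNorm (S : F →ₗ[ℝ] G) (u : F) : ENNReal :=
  wDualNormFun S (innerSL ℝ u)

/-- `‖A‖² = sup_{x ≠ 0} ‖Ax‖_{S,*}² / ‖x‖²`, in `[0, ∞]`. -/
noncomputable def opNormSq (S : F →ₗ[ℝ] G) (A : E →ₗ[ℝ] F) : ENNReal :=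
  ⨆ (x : E) (_ : x ≠ 0), wDualNorm S (A x) ^ 2 / ENNReal.ofReal (‖x‖ ^ 2)

/-- `p` is a smooth prox-function: differentiable, `1`-strongly convex with respect to `‖·‖_S`,
and with `L`-Lipschitz gradient from `‖·‖_S` to the dual norm. -/
structure IsProxFunction (S : F →ₗ[ℝ] G) (p : F → ℝ) (L : ℝ) : Prop where
  one_le : 1 ≤ L
  differentiable : Differentiable ℝ p
  stronglyConvex : ConvexOn ℝ univ (fun z => p z - 1 / 2 * wNorm S z ^ 2)
  lipschitz_grad : ∀ z z',
    wDualNormFun S (fderiv ℝ p z - fderiv ℝ p z') ≤ ENNReal.ofReal (L * wNorm S (z - z'))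

/-- The Bregman distance `b(z, ż) = p(z) - p(ż) - ⟨∇p(ż), z - ż⟩`. -/
noncomputable def bregman (p : F → ℝ) (z zdot : F) : ℝ :=
  p z - p zdot - fderiv ℝ p zdot (z - zdot)

/-- `y` is a maximizer of `⟨u, y⟩ - g*(y) - β b(y, ẏ)` over the whole space. -/
def IsDualStep (g : F → EReal) (p : F → ℝ) (ydot : F) (β : ℝ) (u y : F) : Prop :=
  ∀ y', ((inner ℝ u y' - β * bregman p y' ydot : ℝ) : EReal) - fenchelConj g y' ≤
    ((inner ℝ u y - β * bregman p y ydot : ℝ) : EReal) - fenchelConj g y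

/-- The sequences generated by the accelerated smoothed gap reduction algorithm, started at `x0`
with parameter `β₁`; here `ystar k` is `y*_{β_{k+1}}(A x̂ᵏ; ẏ)`, `L` is the Lipschitz constant of
the gradient of the Bregman distance and `LA` is the squared norm of `A`. The value `β 0` plays
no role. -/
structure IsASGARD (f : E → EReal) (g : F → EReal) (A : E →ₗ[ℝ] F) (p : F → ℝ) (L LA : ℝ)
    (ydot : F) (x0 : E) (β₁ : ℝ) (xbar xhat : ℕ → E) (ystar : ℕ → F) (τ β : ℕ → ℝ) : Prop where
  tau_zero : τ 0 = 1
  beta_one : β 1 = β₁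
  xbar_zero : xbar 0 = x0
  xhat_zero : xhat 0 = x0
  tau_mem : ∀ k, τ (k + 1) ∈ Ioo (0 : ℝ) 1
  tau_root : ∀ k, τ (k + 1) ^ 3 / L + τ (k + 1) ^ 2 + τ k ^ 2 * τ (k + 1) - τ k ^ 2 = 0
  dual_step : ∀ k, IsDualStep g p ydot (β (k + 1)) (A (xhat k)) (ystar k)
  primal_step : ∀ k, IsProx (fun x => ((β (k + 1) / LA : ℝ) : EReal) * f x)
    (xhat k - (β (k + 1) / LA) • LinearMap.adjoint A (ystar k)) (xbar (k + 1))
  xhat_succ : ∀ k, xhat (k + 1) =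
    xbar (k + 1) + (τ (k + 1) * (1 - τ k) / τ k) • (xbar (k + 1) - xbar k)
  beta_succ : ∀ k, β (k + 2) = β (k + 1) / (1 + L⁻¹ * τ (k + 1))

end Weighted

/-! ### Conjugates, subgradients and proximal points of extended-valued functions. -/

section Conjugate

variable {V : Type*} [NormedAddCommGroup V] [InnerProductSpace ℝ V]

/-! Everything follows from one Lyapunov estimate, `IsASGARD.lyapunov`. For every `y` with `g*(y) ≤
r`, the smoothed gap `f(x̄) + ⟨Ax̄, y⟩ - r - β b(y, ẏ) - P⋆` at `x̄ = xbar (k + 1)` is at most `LA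
τ_k² ‖x0 - x⋆‖² / (2 β_{k+1})`.

A single iteration (`smoothed_lagrangian_step`) adds the quadratic growth of the dual subproblem at
its maximizer to that of the proximal subproblem at its minimizer; the growth terms absorb the cross
term `⟨A(x̄ - x̂), y - y₀⟩` by Young's inequality. The step is then compared with the point `(1 - τ)
x̄ + τ x⋆`. The momentum formula makes the distances telescope, the cubic for `τ` makes their
coefficients contract by exactly `1 - τ`, and the update of `β` controls the change of smoothing.
Explicit rates come from `1/(k+1) ≤ τ_k ≤ 2/(k+2)`.

The choice of `y` gives the conclusions. A subgradient of `g` at `Ax̄` turns the gap into `P(x̄) -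
P⋆`. If `g` is the indicator of `{c}`, then `g*` is linear and every `y` is admissible: `y = y⋆`
bounds the objective. For feasibility, a dual solution is a Lagrange multiplier
(`exists_lagrange_multiplier`, by extending a positive functional), and optimizing over `y` around
`ẏ` bounds `‖Ax̄ - c‖`. -/

/-- A real upper bound for the conjugate is an affine minorant of the function. -/
theorem fenchelConj_le_coe_iff {φ : V → EReal} {y : V} {r : ℝ} :
    fenchelConj φ y ≤ (r : EReal) ↔ ∀ v, ((inner ℝ v y - r : ℝ) : EReal) ≤ φ v := by
  rw [fenchelConj, iSup_le_iff]
  refine forall_congr' fun v => ?_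
  induction φ v with
  | bot => simp [-EReal.coe_sub]
  | top => simp
  | coe a =>
    norm_cast
    constructor <;> intro h <;> linarith

theorem IsProperClosedConvex.exists_coe {φ : V → EReal} (h : IsProperClosedConvex φ) {v : V}
    (hv : v ∈ effDom φ) : ∃ r : ℝ, φ v = (r : EReal) :=
  ⟨(φ v).toReal, (EReal.coe_toReal (ne_of_lt hv) (h.ne_bot v)).symm⟩

theorem IsProperClosedConvex.combo_le {φ : V → EReal} (h : IsProperClosedConvex φ) {v w : V}
    {r q a b : ℝ} (hv : φ v ≤ (r : EReal)) (hw : φ w ≤ (q : EReal)) (ha : 0 ≤ a) (hb : 0 ≤ b)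
    (hab : a + b = 1) : φ (a • v + b • w) ≤ ((a * r + b * q : ℝ) : EReal) :=
  h.convex (x := (v, r)) hv (y := (w, q)) hw ha hb hab

theorem fenchelConj_ne_bot {φ : V → EReal} (h : IsProperClosedConvex φ) (y : V) :
    fenchelConj φ y ≠ ⊥ := by
  obtain ⟨v, hv⟩ := h.proper
  obtain ⟨r, hr⟩ := h.exists_coe hv
  intro hbot
  have h1 : ((inner ℝ v y : ℝ) : EReal) - φ v ≤ fenchelConj φ y :=
    le_iSup (fun v => (((inner ℝ v y : ℝ) : EReal) - φ v)) v
  rw [hbot, hr, ← EReal.coe_sub] at h1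
  exact EReal.coe_ne_bot _ (le_bot_iff.1 h1)

theorem fenchelConj_combo_le {φ : V → EReal} {y z : V} {r q a b : ℝ}
    (hy : fenchelConj φ y ≤ (r : EReal)) (hz : fenchelConj φ z ≤ (q : EReal)) (ha : 0 ≤ a)
    (hb : 0 ≤ b) (hab : a + b = 1) :
    fenchelConj φ (a • y + b • z) ≤ ((a * r + b * q : ℝ) : EReal) := by
  rw [fenchelConj_le_coe_iff] at *
  intro v
  specialize hy v
  specialize hz v
  induction hφ : φ v with
  | bot => rw [hφ] at hy; exact absurd (le_bot_iff.1 hy) (EReal.coe_ne_bot _)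
  | top => simp
  | coe t =>
    rw [hφ] at hy hz
    norm_cast at *
    rw [inner_add_right, inner_smul_right, inner_smul_right]
    have h1 := mul_le_mul_of_nonneg_left hy ha
    have h2 := mul_le_mul_of_nonneg_left hz hb
    have h3 : a * t + b * t = t := by rw [← add_mul, hab, one_mul]
    linarith

/-- A subgradient attains the Fenchel–Young inequality. -/
theorem fenchelConj_of_mem_subdiff {φ : V → EReal} {v y : V} {r : ℝ}
    (hr : φ v = (r : EReal)) (hy : y ∈ subdiff φ v) :
    fenchelConj φ y ≤ ((inner ℝ v y - r : ℝ) : EReal) := by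
  rw [fenchelConj_le_coe_iff]
  intro w
  refine le_trans (le_of_eq ?_) (hy.2 w)
  rw [hr, ← EReal.coe_add, EReal.coe_eq_coe_iff, inner_sub_right, real_inner_comm w y,
    real_inner_comm v y]
  ring

theorem fenchelConj_indicatorFun_singleton (c y : V) :
    fenchelConj (indicatorFun {c}) y = ((inner ℝ c y : ℝ) : EReal) := by
  apply le_antisymm
  · rw [fenchelConj_le_coe_iff]
    intro v
    by_cases hv : v = c <;> simp [indicatorFun, hv]
  · refine le_trans (le_of_eq ?_)
      (le_iSup (fun v => (((inner ℝ v y : ℝ) : EReal) - indicatorFun {c} v)) c)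
    simp [indicatorFun]

/-- The defect in this identity is the exact strong convexity of the squared norm; it is the source
of every quadratic growth term below. -/
theorem norm_smul_add_smul_sq (v w : V) (s : ℝ) :
    ‖(1 - s) • v + s • w‖ ^ 2 =
      (1 - s) * ‖v‖ ^ 2 + s * ‖w‖ ^ 2 - s * (1 - s) * ‖w - v‖ ^ 2 := by
  rw [norm_add_sq_real, norm_sub_sq_real, norm_smul, norm_smul, inner_smul_left,
    inner_smul_right, mul_pow, mul_pow, Real.norm_eq_abs, Real.norm_eq_abs, sq_abs, sq_abs,
    real_inner_comm v w]
  simp only [conj_trivial]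
  ring

/-- A limit argument along the segment. -/
theorem le_of_forall_one_sub_mul_le {a b c : ℝ}
    (h : ∀ s ∈ Ioo (0 : ℝ) 1, s * a + s * (1 - s) * c ≤ s * b) : a + c ≤ b := by
  by_contra! hlt
  have hc : 0 < |c| + 1 := by positivity
  -- Small enough that `s * |c|` is at most half of the supposed gap `a + c - b`.
  set s : ℝ := min (1 / 2) ((a + c - b) / (2 * (|c| + 1)))
  have hs0 : 0 < s := lt_min (by norm_num) (div_pos (by linarith) (by linarith))
  have hs1 : s < 1 := lt_of_le_of_lt (min_le_left _ _) (by norm_num)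
  have h1 := h s ⟨hs0, hs1⟩
  have h2 : a + (1 - s) * c ≤ b := by
    refine le_of_mul_le_mul_left ?_ hs0
    linarith
  have h3 : s * (|c| + 1) ≤ (a + c - b) / 2 := by
    have := min_le_right (1 / 2) ((a + c - b) / (2 * (|c| + 1)))
    calc s * (|c| + 1) ≤ (a + c - b) / (2 * (|c| + 1)) * (|c| + 1) := by gcongr
      _ = _ := by field_simp
  nlinarith [le_abs_self c]

/-- Finiteness and quadratic growth at a value of the proximal operator. -/
theorem IsProx.exists_coe {f : V → EReal} (hf : IsProperClosedConvex f) {t : ℝ} (ht : 0 < t)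
    {z u : V} (h : IsProx (fun x => ((t : ℝ) : EReal) * f x) z u) :
    ∃ r : ℝ, f u = (r : EReal) := by
  obtain ⟨v, hv⟩ := hf.proper
  obtain ⟨q, hq⟩ := hf.exists_coe hv
  refine hf.exists_coe (show f u < ⊤ from lt_top_iff_ne_top.2 fun htop => ?_)
  have h1 := h v
  simp only [htop, hq] at h1
  rw [EReal.coe_mul_top_of_pos ht, EReal.top_add_coe, ← EReal.coe_mul, ← EReal.coe_add] at h1
  exact EReal.coe_ne_top _ (top_le_iff.1 h1)

theorem IsProx.quadratic_growth {f : V → EReal} (hf : IsProperClosedConvex f) {t : ℝ} (ht : 0 < t)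
    {z u x : V} (h : IsProx (fun x => ((t : ℝ) : EReal) * f x) z u) {r q : ℝ}
    (hu : f u = (r : EReal)) (hx : f x ≤ (q : EReal)) :
    t * r + 1 / 2 * ‖u - z‖ ^ 2 + 1 / 2 * ‖x - u‖ ^ 2 ≤ t * q + 1 / 2 * ‖x - z‖ ^ 2 := by
  apply le_of_forall_one_sub_mul_le
  rintro s ⟨hs0, hs1⟩
  -- Testing minimality on the segment towards `x` and letting `s → 0` recovers the full coefficient
  -- `1/2` of the growth term.
  have h1 := h ((1 - s) • u + s • x)
  have h2 := hf.combo_le hu.le hx (by linarith : 0 ≤ 1 - s) hs0.le (by ring)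
  have h3 : ((t : ℝ) : EReal) * f ((1 - s) • u + s • x) ≤
      ((t * ((1 - s) * r + s * q) : ℝ) : EReal) := by
    rw [EReal.coe_mul]
    exact mul_le_mul_of_nonneg_left h2 (by exact_mod_cast ht.le)
  have h4 := h1.trans (add_le_add_left h3 _)
  simp only [hu] at h4
  norm_cast at h4
  have e1 : (1 - s) • u + s • x - z = (1 - s) • (u - z) + s • (x - z) := by module
  have e2 : x - u = (x - z) - (u - z) := by abel
  rw [e1, norm_smul_add_smul_sq] at h4
  rw [e2]
  linarith

end Conjugate

/-! ### The weighted seminorm, its dual norm, and Bregman distances. -/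

section Weighted

variable {F G : Type*} [NormedAddCommGroup F] [InnerProductSpace ℝ F]
  [NormedAddCommGroup G] [InnerProductSpace ℝ G]

/-- Homogeneity reduces to the unit ball, except on the kernel of `S`: there all multiples of `v`
lie in the ball, so a finite bound forces `φ v ≤ 0`. -/
theorem le_mul_wNorm_of_wDualNormFun_le {S : F →ₗ[ℝ] G} {φ : F →L[ℝ] ℝ} {M : ℝ} (hM : 0 ≤ M)
    (h : wDualNormFun S φ ≤ ENNReal.ofReal M) (v : F) : φ v ≤ M * wNorm S v := by
  have key : ∀ w, wNorm S w ≤ 1 → φ w ≤ M := by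
    intro w hw
    have h1 : ENNReal.ofReal (φ w) ≤ ENNReal.ofReal M :=
      le_trans (le_iSup₂ (f := fun (v : F) (_ : wNorm S v ≤ 1) => ENNReal.ofReal (φ v)) w hw) h
    exact (ENNReal.ofReal_le_ofReal_iff hM).1 h1
  rcases eq_or_lt_of_le (norm_nonneg (S v)) with h0 | h0
  · have hv : wNorm S v = 0 := h0.symm
    rw [hv, mul_zero]
    by_contra! hpos
    have h1 := key (((M + 1) / φ v) • v) (by
      have : S v = 0 := norm_eq_zero.1 h0.symm
      simp [wNorm, this])
    rw [map_smul, smul_eq_mul, div_mul_cancel₀ _ hpos.ne'] at h1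
    linarith
  · have h1 := key ((wNorm S v)⁻¹ • v) (by
      simp only [wNorm, map_smul, norm_smul, norm_inv, norm_norm]
      exact (inv_mul_cancel₀ h0.ne').le)
    rw [map_smul, smul_eq_mul, inv_mul_le_iff₀ (show 0 < wNorm S v from h0)] at h1
    linarith

theorem wDualNorm_le_ofReal {S : F →ₗ[ℝ] G} {u : F} {M : ℝ}
    (h : ∀ v, wNorm S v ≤ 1 → inner ℝ u v ≤ M) : wDualNorm S u ≤ ENNReal.ofReal M :=
  iSup₂_le fun v hv => ENNReal.ofReal_le_ofReal (h v hv)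

theorem inner_le_wDualNorm_mul {S : F →ₗ[ℝ] G} {u : F} (h : wDualNorm S u ≠ ⊤) (v : F) :
    inner ℝ u v ≤ (wDualNorm S u).toReal * wNorm S v :=
  le_mul_wNorm_of_wDualNormFun_le (φ := innerSL ℝ u) ENNReal.toReal_nonneg
    (by rw [ENNReal.ofReal_toReal h]; exact le_rfl) v

/-- Besides the operator bound, this gives finiteness of the dual norm on the range of `A`, where
the seminorm alone would allow `⊤`. -/
theorem wDualNorm_map_le {E : Type*} [NormedAddCommGroup E] [InnerProductSpace ℝ E]
    {S : F →ₗ[ℝ] G} {A : E →ₗ[ℝ] F} {LA : ℝ} (hpos : 0 < LA)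
    (hLA : opNormSq S A = ENNReal.ofReal LA) (x : E) :
    wDualNorm S (A x) ≤ ENNReal.ofReal (Real.sqrt LA * ‖x‖) := by
  by_cases hx : x = 0
  · subst hx
    refine (wDualNorm_le_ofReal (M := 0) ?_).trans (by simp)
    simp
  have hx' : 0 < ‖x‖ := norm_pos_iff.2 hx
  have h1 : wDualNorm S (A x) ^ 2 / ENNReal.ofReal (‖x‖ ^ 2) ≤ ENNReal.ofReal LA := by
    rw [← hLA]
    exact le_iSup₂ (f := fun (x : E) (_ : x ≠ 0) =>
      wDualNorm S (A x) ^ 2 / ENNReal.ofReal (‖x‖ ^ 2)) x hx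
  rw [ENNReal.div_le_iff (by simpa using hx) (by simp), ← ENNReal.ofReal_mul hpos.le] at h1
  have h2 : LA * ‖x‖ ^ 2 = (Real.sqrt LA * ‖x‖) ^ 2 := by
    rw [mul_pow, Real.sq_sqrt hpos.le]
  rw [h2, ENNReal.ofReal_pow (by positivity)] at h1
  exact (ENNReal.pow_right_strictMono two_ne_zero).le_iff_le.1 h1

theorem wNorm_smul_add_smul_sq (S : F →ₗ[ℝ] G) (v w : F) (s : ℝ) :
    wNorm S ((1 - s) • v + s • w) ^ 2 =
      (1 - s) * wNorm S v ^ 2 + s * wNorm S w ^ 2 - s * (1 - s) * wNorm S (w - v) ^ 2 := by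
  simp only [wNorm, map_add, map_smul, map_sub, norm_smul_add_smul_sq]

/-- Strong convexity of a prox-function along a segment. -/
theorem IsProxFunction.segment_le {S : F →ₗ[ℝ] G} {p : F → ℝ} {L : ℝ} (hp : IsProxFunction S p L)
    (v w : F) {s : ℝ} (hs0 : 0 ≤ s) (hs1 : s ≤ 1) :
    p ((1 - s) • v + s • w) + 1 / 2 * (s * (1 - s) * wNorm S (w - v) ^ 2) ≤
      (1 - s) * p v + s * p w := by
  have h := hp.stronglyConvex.2 (mem_univ v) (mem_univ w) (by linarith : 0 ≤ 1 - s) hs0 (by ring)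
  simp only [smul_eq_mul, wNorm_smul_add_smul_sq] at h
  linarith

theorem hasDerivAt_comp_line {p : F → ℝ} (hp : Differentiable ℝ p) (v w : F) (t : ℝ) :
    HasDerivAt (fun s : ℝ => p (v + s • w)) (fderiv ℝ p (v + t • w) w) t := by
  have h1 : HasDerivAt (fun s : ℝ => v + s • w) w t := by
    simpa using ((hasDerivAt_id t).smul_const w).const_add v
  exact (hp (v + t • w)).hasFDerivAt.comp_hasDerivAt t h1

theorem IsProxFunction.bregman_nonneg {S : F →ₗ[ℝ] G} {p : F → ℝ} {L : ℝ}
    (hp : IsProxFunction S p L) (y z : F) : 0 ≤ bregman p y z := by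
  have hd := hasDerivAt_comp_line hp.differentiable z (y - z) 0
  simp only [zero_smul, add_zero] at hd
  have hconv : ConvexOn ℝ univ p := by
    have h2 : ConvexOn ℝ univ fun z => 1 / 2 * wNorm S z ^ 2 := by
      refine ⟨convex_univ, fun v _ w _ a b ha hb hab => ?_⟩
      obtain rfl : a = 1 - b := by linarith
      simp only [wNorm_smul_add_smul_sq, smul_eq_mul]
      nlinarith [mul_nonneg (mul_nonneg hb ha) (sq_nonneg (wNorm S (w - v)))]
    have := hp.stronglyConvex.add h2
    simpa [Pi.add_def] using this
  have hline : ConvexOn ℝ univ (fun s : ℝ => p (z + s • (y - z))) := by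
    have := hconv.comp_affineMap (AffineMap.lineMap z y)
    simpa [Function.comp_def, AffineMap.lineMap_apply, add_comm] using this
  have h := hline.le_slope_of_hasDerivAt (mem_univ 0) (mem_univ 1) zero_lt_one hd
  simp [slope] at h
  simp [bregman]
  linarith

/-- The descent lemma. -/
theorem IsProxFunction.bregman_le {S : F →ₗ[ℝ] G} {p : F → ℝ} {L : ℝ}
    (hp : IsProxFunction S p L) (y z : F) : bregman p y z ≤ L / 2 * wNorm S (y - z) ^ 2 := by
  set w := y - z
  have hL : 0 ≤ L := zero_le_one.trans hp.one_le
  have hw : 0 ≤ wNorm S w := norm_nonneg _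
  have hbound : ∀ t : ℝ, 0 ≤ t →
      fderiv ℝ p (z + t • w) w - fderiv ℝ p z w ≤ L * t * wNorm S w ^ 2 := by
    intro t ht
    have h1 := hp.lipschitz_grad (z + t • w) z
    have h2 := le_mul_wNorm_of_wDualNormFun_le
      (M := L * wNorm S (z + t • w - z)) (mul_nonneg hL (norm_nonneg _)) h1 w
    have h3 : wNorm S (z + t • w - z) = t * wNorm S w := by
      simp [wNorm, norm_smul, abs_of_nonneg ht]
    rw [h3] at h2
    simp only [sub_apply] at h2
    linarith
  -- `ψ` is the quadratic upper model minus `p` along the segment. Its derivative is nonnegative by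
  -- `hbound`, and `ψ 0 ≤ ψ 1` is the claim.
  set ψ : ℝ → ℝ := fun s => L / 2 * wNorm S w ^ 2 * s ^ 2 + fderiv ℝ p z w * s - p (z + s • w)
  have hψ : ∀ t, HasDerivAt ψ
      (L / 2 * wNorm S w ^ 2 * (2 * t) + fderiv ℝ p z w - fderiv ℝ p (z + t • w) w) t := by
    intro t
    refine HasDerivAt.sub (HasDerivAt.add ?_ ?_) (hasDerivAt_comp_line hp.differentiable z w t)
    · simpa using (hasDerivAt_pow 2 t).const_mul (L / 2 * wNorm S w ^ 2)
    · simpa using (hasDerivAt_id t).const_mul (fderiv ℝ p z w)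
  have hmono : MonotoneOn ψ (Icc 0 1) := by
    refine monotoneOn_of_deriv_nonneg (convex_Icc 0 1)
      (fun t _ => (hψ t).continuousAt.continuousWithinAt)
      (fun t _ => (hψ t).differentiableAt.differentiableWithinAt) fun t ht => ?_
    rw [interior_Icc] at ht
    rw [(hψ t).deriv]
    linarith [hbound t ht.1.le]
  have h := hmono (left_mem_Icc.2 zero_le_one) (right_mem_Icc.2 zero_le_one) zero_le_one
  have hy : z + w = y := by simp [w]
  simp [ψ, hy] at h
  simp only [bregman]
  linarith

theorem IsDualStep.exists_coe {g : F → EReal} (hg : IsProperClosedConvex g) {p : F → ℝ}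
    {ydot u y : F} {β : ℝ} (h : IsDualStep g p ydot β u y)
    (hdom : ∃ z, fenchelConj g z ≠ ⊤) : ∃ r : ℝ, fenchelConj g y = (r : EReal) := by
  obtain ⟨z, hz⟩ := hdom
  have h1 := h z
  lift fenchelConj g z to ℝ using ⟨hz, fenchelConj_ne_bot hg z⟩ with a
  refine ⟨(fenchelConj g y).toReal, (EReal.coe_toReal ?_ (fenchelConj_ne_bot hg y)).symm⟩
  intro htop
  rw [htop, ← EReal.coe_sub, EReal.sub_top] at h1
  exact EReal.coe_ne_bot _ (le_bot_iff.1 h1)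

/-- Quadratic growth of the smoothed dual subproblem at its maximizer. -/
theorem IsDualStep.quadratic_growth {g : F → EReal} {S : F →ₗ[ℝ] G} {p : F → ℝ} {L : ℝ}
    (hp : IsProxFunction S p L) {ydot u y z : F} {β : ℝ} (hβ : 0 ≤ β)
    (h : IsDualStep g p ydot β u y) {r q : ℝ}
    (hy : fenchelConj g y = (r : EReal)) (hz : fenchelConj g z ≤ (q : EReal)) :
    inner ℝ u z - β * bregman p z ydot - q + β / 2 * wNorm S (z - y) ^ 2 ≤
      inner ℝ u y - β * bregman p y ydot - r := by
  suffices H : inner ℝ u z - β * bregman p z ydot - q - (inner ℝ u y - β * bregman p y ydot - r) +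
      β / 2 * wNorm S (z - y) ^ 2 ≤ 0 by linarith
  apply le_of_forall_one_sub_mul_le
  rintro s ⟨hs0, hs1⟩
  have h1 := h ((1 - s) • y + s • z)
  have h2 := fenchelConj_combo_le hy.le hz (by linarith : 0 ≤ 1 - s) hs0.le (by ring)
  have h3 := (EReal.sub_le_sub le_rfl h2).trans h1
  rw [hy] at h3
  norm_cast at h3
  rw [inner_add_right, inner_smul_right, inner_smul_right] at h3
  have h4 := hp.segment_le y z hs0.le hs1.le
  have h5 : bregman p ((1 - s) • y + s • z) ydot +
      1 / 2 * (s * (1 - s) * wNorm S (z - y) ^ 2) ≤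
      (1 - s) * bregman p y ydot + s * bregman p z ydot := by
    have e : (1 - s) • y + s • z - ydot = (1 - s) • (y - ydot) + s • (z - ydot) := by module
    simp only [bregman, e, map_add, map_smul, smul_eq_mul]
    linarith
  have h6 := mul_le_mul_of_nonneg_left h5 hβ
  linarith

end Weighted

/-! ### Lagrange multipliers under Slater's condition. -/

section Duality

variable {E F : Type*} [NormedAddCommGroup E] [InnerProductSpace ℝ E]
  [NormedAddCommGroup F] [InnerProductSpace ℝ F] [FiniteDimensional ℝ F]

/-- From a point of the relative interior one can move a little in every direction of the
affine span. -/
theorem exists_pos_add_smul_mem_of_mem_intrinsicInterior {s : Set E} {x d : E}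
    (hx : x ∈ intrinsicInterior ℝ s) (hd : d ∈ (affineSpan ℝ s).direction) :
    ∃ ε : ℝ, 0 < ε ∧ x + ε • d ∈ s := by
  obtain ⟨y, hy, rfl⟩ := mem_intrinsicInterior.1 hx
  have hmem : ∀ t : ℝ, (y : E) + t • d ∈ affineSpan ℝ s := fun t => by
    rw [add_comm]
    exact AffineSubspace.vadd_mem_of_mem_direction (Submodule.smul_mem _ t hd) y.2
  let γ : ℝ → affineSpan ℝ s := fun t => ⟨(y : E) + t • d, hmem t⟩
  have hγ : Continuous γ := by
    refine Continuous.subtype_mk ?_ _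
    fun_prop
  have h0 : γ 0 = y := by ext; simp [γ]
  have hn : ∀ᶠ t in nhds (0 : ℝ), γ t ∈ ((↑) ⁻¹' s : Set (affineSpan ℝ s)) :=
    hγ.continuousAt.eventually (by rw [h0]; exact mem_interior_iff_mem_nhds.1 hy)
  obtain ⟨ε, hε, h⟩ := Metric.eventually_nhds_iff.1 hn
  refine ⟨ε / 2, by positivity, ?_⟩
  exact h (by simp [abs_of_pos hε, hε])

/-- Existence of a Lagrange multiplier for the constraint `A x = c` under Slater's condition. -/
theorem exists_lagrange_multiplier {f : E → EReal} (hf : IsProperClosedConvex f)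
    (A : E →ₗ[ℝ] F) {c : F} {x₁ : E} (hx₁ : x₁ ∈ intrinsicInterior ℝ (effDom f))
    (hAx₁ : A x₁ = c) {m : ℝ} (hm : ∀ x, A x = c → (m : EReal) ≤ f x) :
    ∃ y : F, ∀ x, ((m - inner ℝ (A x - c) y : ℝ) : EReal) ≤ f x := by
  -- A relative interior point allows moves only along the affine span, so the separation takes
  -- place in `M`, the image of its direction, rather than in all of `F`.
  set W := (affineSpan ℝ (effDom f)).direction
  set M := W.map A
  have hx₁' := intrinsicInterior_subset hx₁
  have hM : ∀ x ∈ effDom f, A x - c ∈ M := fun x hx => by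
    refine ⟨x - x₁, ?_, by simp [hAx₁]⟩
    exact AffineSubspace.vsub_mem_direction (subset_affineSpan ℝ _ hx)
      (subset_affineSpan ℝ _ hx₁')
  obtain ⟨r₁, hr₁⟩ : ∃ r : ℝ, f x₁ = (r : EReal) :=
    ⟨(f x₁).toReal, (EReal.coe_toReal (ne_of_lt hx₁') (hf.ne_bot x₁)).symm⟩
  -- The cone generated by the pairs `(A x - c, r - m)` with `(x, r)` in the epigraph of `f`. A
  -- functional nonnegative on `K` and equal to the height on `{0} × ℝ` encodes a multiplier.
  let K : PointedCone ℝ (M × ℝ) :=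
    { carrier := {q | ∃ t : ℝ, 0 ≤ t ∧ ∃ (x : E) (r : ℝ), f x ≤ (r : EReal) ∧
        (q.1 : F) = t • (A x - c) ∧ q.2 = t * (r - m)}
      zero_mem' := ⟨0, le_rfl, x₁, r₁, hr₁.le, by simp, by simp⟩
      smul_mem' := by
        rintro ⟨a, ha⟩ q ⟨t, ht, x, r, hx, h1, h2⟩
        refine ⟨a * t, mul_nonneg ha ht, x, r, hx, ?_, ?_⟩
        · simp [Nonneg.mk_smul, h1, mul_smul]
        · simp [Nonneg.mk_smul, h2, mul_assoc]
      add_mem' := by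
        rintro q q' ⟨t, ht, x, r, hx, h1, h2⟩ ⟨t', ht', x', r', hx', h1', h2'⟩
        rcases eq_or_lt_of_le (add_nonneg ht ht') with h0 | h0
        · have e1 : t = 0 := by linarith
          have e2 : t' = 0 := by linarith
          refine ⟨0, le_rfl, x, r, hx, ?_, ?_⟩
          · simp [h1, h1', e1, e2]
          · simp [h2, h2', e1, e2]
        · have hab : t / (t + t') + t' / (t + t') = 1 := by field_simp
          refine ⟨t + t', h0.le, (t / (t + t')) • x + (t' / (t + t')) • x',
            t / (t + t') * r + t' / (t + t') * r',
            hf.convex (x := (x, r)) hx (y := (x', r')) hx' (by positivity) (by positivity) hab,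
            ?_, ?_⟩
          · have e1 : (t + t') * (t / (t + t')) = t := by field_simp
            have e2 : (t + t') * (t' / (t + t')) = t' := by field_simp
            simp only [Prod.fst_add, Submodule.coe_add, h1, h1', map_add, map_smul, smul_sub,
              smul_add, smul_smul, e1, e2, add_smul]
            abel
          · simp only [Prod.snd_add, h2, h2']
            field_simp
            ring }
  let φ : (M × ℝ) →ₗ.[ℝ] ℝ :=
    ⟨LinearMap.range (LinearMap.inr ℝ M ℝ),
      (LinearMap.snd ℝ M ℝ).comp (Submodule.subtype _)⟩
  obtain ⟨ψ, hψφ, hψ⟩ := riesz_extension K φ (by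
      -- Positivity on the vertical axis: a point of `K` over `0` has `t = 0` or comes from a
      -- feasible `x`, where `m ≤ f x`.
      rintro ⟨_, b, rfl⟩ ⟨t, ht, x, r, hx, h1, h2⟩
      change 0 ≤ b
      simp only [LinearMap.inr_apply, Submodule.coe_zero] at h1 h2
      rcases eq_or_lt_of_le ht with h0 | h0
      · simp [h2, ← h0]
      · have hAx : A x = c := by
          have := (smul_eq_zero.1 h1.symm).resolve_left h0.ne'
          exact sub_eq_zero.1 this
        have := (hm x hAx).trans hx
        norm_cast at this
        rw [h2]
        exact mul_nonneg ht (by linarith)) (by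
      -- Slater's condition enters here: a small move from `x₁` along `d` stays in the domain, so a
      -- vertical shift brings any point of `M × ℝ` into `K`.
      rintro ⟨⟨w, d, hd, rfl⟩, b⟩
      obtain ⟨ε, hε, hmem⟩ := exists_pos_add_smul_mem_of_mem_intrinsicInterior hx₁ hd
      set r := (f (x₁ + ε • d)).toReal
      have hr : f (x₁ + ε • d) = (r : EReal) :=
        (EReal.coe_toReal (ne_of_lt hmem) (hf.ne_bot _)).symm
      refine ⟨⟨(0, ε⁻¹ * (r - m) - b), ⟨_, rfl⟩⟩, ε⁻¹, by positivity, x₁ + ε • d, r, hr.le, ?_, ?_⟩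
      · simp [hAx₁, smul_smul, hε.ne']
      · simp)
  obtain ⟨η, hη⟩ := LinearMap.exists_extend (ψ.comp (LinearMap.inl ℝ M ℝ))
  refine ⟨(InnerProductSpace.toDual ℝ F).symm η.toContinuousLinearMap, fun x => ?_⟩
  by_cases hx : f x = ⊤
  · simp [hx]
  have hx' : x ∈ effDom f := lt_top_iff_ne_top.2 hx
  set r := (f x).toReal
  have hr : f x = (r : EReal) := (EReal.coe_toReal hx (hf.ne_bot _)).symm
  have h1 := hψ (⟨A x - c, hM x hx'⟩, r - m) ⟨1, zero_le_one, x, r, hr.le, by simp, by simp⟩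
  have h2 : ψ (0, r - m) = r - m := hψφ ⟨(0, r - m), ⟨_, rfl⟩⟩
  have h3 : ψ (⟨A x - c, hM x hx'⟩, 0) = η (A x - c) :=
    (LinearMap.congr_fun hη ⟨A x - c, hM x hx'⟩).symm
  have h4 : ψ (⟨A x - c, hM x hx'⟩, r - m) =
      ψ (⟨A x - c, hM x hx'⟩, 0) + ψ (0, r - m) := by
    rw [← map_add]; simp
  rw [hr, EReal.coe_le_coe_iff, real_inner_comm, InnerProductSpace.toDual_symm_apply]
  simp only [LinearMap.coe_toContinuousLinearMap']
  linarith

end Duality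

/-! ### Rates of the parameters `τ` and `β`. -/

section Parameters

variable {τ β : ℕ → ℝ}

theorem tau_pos (h0 : τ 0 = 1) (hmem : ∀ k, τ (k + 1) ∈ Ioo (0 : ℝ) 1) (k : ℕ) : 0 < τ k := by
  cases k with
  | zero => rw [h0]; exact one_pos
  | succ k => exact (hmem k).1

/-- Comparison of the root of the cubic with a given number. -/
theorem cubic_lt {t s a : ℝ} (hs : 0 < s) (hst : s < t) :
    s ^ 3 / 1 + s ^ 2 + a ^ 2 * s - a ^ 2 < t ^ 3 / 1 + t ^ 2 + a ^ 2 * t - a ^ 2 := by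
  have h3 : s ^ 3 < t ^ 3 := by gcongr
  have h2 : s ^ 2 < t ^ 2 := by gcongr
  have h1 : a ^ 2 * s ≤ a ^ 2 * t := by gcongr
  linarith

/-- The cubic is increasing in `τ > 0`, and with `1/(k+1) ≤ τ_k` it is nonpositive at `1/(k+2)`; its
root therefore lies to the right. The upper bound below is the mirror argument. -/
theorem one_div_le_tau (h0 : τ 0 = 1) (hmem : ∀ k, τ (k + 1) ∈ Ioo (0 : ℝ) 1)
    (hroot : ∀ k, τ (k + 1) ^ 3 / 1 + τ (k + 1) ^ 2 + τ k ^ 2 * τ (k + 1) - τ k ^ 2 = 0) (k : ℕ) :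
    1 / ((k : ℝ) + 1) ≤ τ k := by
  induction k with
  | zero => simp [h0]
  | succ k ih =>
    by_contra! hlt
    have h1 := cubic_lt (a := τ k) (hmem k).1 hlt
    rw [hroot k] at h1
    push_cast at h1
    have h2 : (1 / ((k : ℝ) + 1)) ^ 2 ≤ τ k ^ 2 := by gcongr
    have h3 : (1 / ((k : ℝ) + 1)) ^ 2 * (1 - 1 / ((k : ℝ) + 1 + 1)) ≤
        τ k ^ 2 * (1 - 1 / ((k : ℝ) + 1 + 1)) := by
      gcongr
      rw [sub_nonneg, div_le_one (by positivity)]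
      linarith [(Nat.cast_nonneg k : (0 : ℝ) ≤ k)]
    have h4 : (1 / ((k : ℝ) + 1 + 1)) ^ 3 + (1 / ((k : ℝ) + 1 + 1)) ^ 2 ≤
        (1 / ((k : ℝ) + 1)) ^ 2 * (1 - 1 / ((k : ℝ) + 1 + 1)) := by
      have e : (1 / ((k : ℝ) + 1)) ^ 2 * (1 - 1 / ((k : ℝ) + 1 + 1)) -
          ((1 / ((k : ℝ) + 1 + 1)) ^ 3 + (1 / ((k : ℝ) + 1 + 1)) ^ 2) =
          1 / (((k : ℝ) + 1) * ((k : ℝ) + 1 + 1) ^ 3) := by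
        field_simp
        ring
      have : 0 ≤ 1 / (((k : ℝ) + 1) * ((k : ℝ) + 1 + 1) ^ 3) := by positivity
      linarith
    linarith

theorem tau_le_two_div (h0 : τ 0 = 1) (hmem : ∀ k, τ (k + 1) ∈ Ioo (0 : ℝ) 1)
    (hroot : ∀ k, τ (k + 1) ^ 3 / 1 + τ (k + 1) ^ 2 + τ k ^ 2 * τ (k + 1) - τ k ^ 2 = 0) (k : ℕ) :
    τ k ≤ 2 / ((k : ℝ) + 2) := by
  induction k with
  | zero => simp [h0]
  | succ k ih =>
    by_contra! hlt
    have h1 := cubic_lt (a := τ k) (by positivity) hlt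
    rw [hroot k] at h1
    push_cast at h1
    have h2 : τ k ^ 2 ≤ (2 / ((k : ℝ) + 2)) ^ 2 := by
      have := (tau_pos h0 hmem k).le
      gcongr
    have h3 : τ k ^ 2 * (1 - 2 / ((k : ℝ) + 1 + 2)) ≤
        (2 / ((k : ℝ) + 2)) ^ 2 * (1 - 2 / ((k : ℝ) + 1 + 2)) := by
      gcongr
      rw [sub_nonneg, div_le_one (by positivity)]
      linarith [(Nat.cast_nonneg k : (0 : ℝ) ≤ k)]
    have h4 : (2 / ((k : ℝ) + 2)) ^ 2 * (1 - 2 / ((k : ℝ) + 1 + 2)) ≤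
        (2 / ((k : ℝ) + 1 + 2)) ^ 3 + (2 / ((k : ℝ) + 1 + 2)) ^ 2 := by
      have e : (2 / ((k : ℝ) + 1 + 2)) ^ 3 + (2 / ((k : ℝ) + 1 + 2)) ^ 2 -
          (2 / ((k : ℝ) + 2)) ^ 2 * (1 - 2 / ((k : ℝ) + 1 + 2)) =
          4 * (2 * (k : ℝ) ^ 2 + 9 * k + 11) / (((k : ℝ) + 1 + 2) ^ 3 * ((k : ℝ) + 2) ^ 2) := by
        field_simp
        ring
      have : 0 ≤ 4 * (2 * (k : ℝ) ^ 2 + 9 * k + 11) /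
        (((k : ℝ) + 1 + 2) ^ 3 * ((k : ℝ) + 2) ^ 2) := by positivity
      linarith
    linarith

theorem beta_pos (h0 : τ 0 = 1) (hmem : ∀ k, τ (k + 1) ∈ Ioo (0 : ℝ) 1) (h1 : 0 < β 1)
    (hβ : ∀ k, β (k + 2) = β (k + 1) / (1 + 1⁻¹ * τ (k + 1))) (k : ℕ) : 0 < β (k + 1) := by
  induction k with
  | zero => exact h1
  | succ k ih =>
    rw [hβ k]
    have := tau_pos h0 hmem (k + 1)
    positivity

/-- The lower bound on `τ` gives `1 + τ_{k+1} ≥ (k+3)/(k+2)`, and these factors telescope. -/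
theorem beta_le (h0 : τ 0 = 1) (hmem : ∀ k, τ (k + 1) ∈ Ioo (0 : ℝ) 1)
    (hroot : ∀ k, τ (k + 1) ^ 3 / 1 + τ (k + 1) ^ 2 + τ k ^ 2 * τ (k + 1) - τ k ^ 2 = 0)
    (h1 : 0 < β 1) (hβ : ∀ k, β (k + 2) = β (k + 1) / (1 + 1⁻¹ * τ (k + 1))) (k : ℕ) :
    β (k + 1) ≤ 2 * β 1 / ((k : ℝ) + 2) := by
  induction k with
  | zero => simp
  | succ k ih =>
    have ht := one_div_le_tau h0 hmem hroot (k + 1)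
    have hτ := tau_pos h0 hmem (k + 1)
    push_cast at ht ⊢
    rw [hβ k, inv_one, one_mul, div_le_iff₀ (by positivity)]
    calc β (k + 1) ≤ 2 * β 1 / ((k : ℝ) + 2) := ih
      _ = 2 * β 1 / ((k : ℝ) + 1 + 2) * (1 + 1 / ((k : ℝ) + 1 + 1)) := by
        field_simp
        ring
      _ ≤ _ := by gcongr

/-- The rate function of the Lyapunov argument contracts by the factor `1 - τ`. -/
theorem tau_sq_div_beta_succ (h0 : τ 0 = 1) (hmem : ∀ k, τ (k + 1) ∈ Ioo (0 : ℝ) 1)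
    (hroot : ∀ k, τ (k + 1) ^ 3 / 1 + τ (k + 1) ^ 2 + τ k ^ 2 * τ (k + 1) - τ k ^ 2 = 0)
    (h1 : 0 < β 1) (hβ : ∀ k, β (k + 2) = β (k + 1) / (1 + 1⁻¹ * τ (k + 1))) (k : ℕ) :
    τ (k + 1) ^ 2 / β (k + 2) = (1 - τ (k + 1)) * (τ k ^ 2 / β (k + 1)) := by
  have hb := beta_pos h0 hmem h1 hβ k
  have hτ := tau_pos h0 hmem (k + 1)
  -- With denominators cleared, the claim `τ_{k+1}² (1 + τ_{k+1}) = (1 - τ_{k+1}) τ_k²` is the cubic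
  -- itself.
  have h := hroot k
  rw [hβ k, inv_one, one_mul]
  field_simp
  linarith

/-- The contraction factors satisfy `1 - τ_{k+1} ≤ (k+1)/(k+2)`, whose product telescopes. -/
theorem tau_sq_div_beta_le (h0 : τ 0 = 1) (hmem : ∀ k, τ (k + 1) ∈ Ioo (0 : ℝ) 1)
    (hroot : ∀ k, τ (k + 1) ^ 3 / 1 + τ (k + 1) ^ 2 + τ k ^ 2 * τ (k + 1) - τ k ^ 2 = 0)
    (h1 : 0 < β 1) (hβ : ∀ k, β (k + 2) = β (k + 1) / (1 + 1⁻¹ * τ (k + 1))) (k : ℕ) :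
    τ k ^ 2 / β (k + 1) ≤ 1 / (β 1 * ((k : ℝ) + 1)) := by
  induction k with
  | zero => simp [h0]
  | succ k ih =>
    have ht := one_div_le_tau h0 hmem hroot (k + 1)
    have hτ := (hmem k).2
    rw [tau_sq_div_beta_succ h0 hmem hroot h1 hβ k]
    push_cast at ht ⊢
    calc (1 - τ (k + 1)) * (τ k ^ 2 / β (k + 1))
        ≤ (1 - τ (k + 1)) * (1 / (β 1 * ((k : ℝ) + 1))) := by gcongr
      _ ≤ (1 - 1 / ((k : ℝ) + 1 + 1)) * (1 / (β 1 * ((k : ℝ) + 1))) := by gcongr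
      _ = 1 / (β 1 * ((k : ℝ) + 1 + 1)) := by
        field_simp
        ring

end Parameters

/-! ### One-step estimate and Lyapunov induction. -/

section Algorithm

variable {E F G : Type*} [NormedAddCommGroup E] [InnerProductSpace ℝ E] [FiniteDimensional ℝ E]
  [NormedAddCommGroup F] [InnerProductSpace ℝ F] [FiniteDimensional ℝ F]
  [NormedAddCommGroup G] [InnerProductSpace ℝ G]

/-- One primal-dual step of the algorithm decreases the smoothed Lagrangian. -/
theorem smoothed_lagrangian_step {f : E → EReal} {g : F → EReal} {A : E →ₗ[ℝ] F}
    (hf : IsProperClosedConvex f) {S : F →ₗ[ℝ] G} {p : F → ℝ} {L : ℝ}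
    (hp : IsProxFunction S p L) {LA : ℝ} (hLA_pos : 0 < LA)
    (hLA : opNormSq S A = ENNReal.ofReal LA) {ydot y₀ y : F} {xh xp x : E} {β : ℝ} (hβ : 0 < β)
    (hd : IsDualStep g p ydot β (A xh) y₀)
    (hx : IsProx (fun x => ((β / LA : ℝ) : EReal) * f x)
      (xh - (β / LA) • LinearMap.adjoint A y₀) xp)
    {r₀ r a q : ℝ} (hr₀ : fenchelConj g y₀ = (r₀ : EReal)) (hr : fenchelConj g y ≤ (r : EReal))
    (ha : f xp = (a : EReal)) (hq : f x ≤ (q : EReal)) :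
    a + inner ℝ (A xp) y - r - β * bregman p y ydot + LA / (2 * β) * ‖x - xp‖ ^ 2 ≤
      q + inner ℝ (A x) y₀ - r₀ - β * bregman p y₀ ydot + LA / (2 * β) * ‖x - xh‖ ^ 2 := by
  have h1 := hd.quadratic_growth hp hβ.le hr₀ hr
  have h2 := hx.quadratic_growth hf (div_pos hβ hLA_pos) ha hq
  have e : ∀ v : E, ‖v - (xh - (β / LA) • LinearMap.adjoint A y₀)‖ ^ 2 =
      ‖v - xh‖ ^ 2 + 2 * (β / LA) * (inner ℝ (A v) y₀ - inner ℝ (A xh) y₀) +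
        ‖(β / LA) • LinearMap.adjoint A y₀‖ ^ 2 := by
    intro v
    rw [← sub_add, norm_add_sq_real, inner_smul_right, LinearMap.adjoint_inner_right, map_sub,
      inner_sub_left]
    ring
  rw [e, e] at h2
  -- The dual step was taken at `xh` but the gap is measured at `xp`; this cross term is the price,
  -- and `h4` splits it exactly into the two available growth terms.
  have h3 : inner ℝ (A (xp - xh)) (y - y₀) ≤
      Real.sqrt LA * ‖xp - xh‖ * wNorm S (y - y₀) :=
    le_mul_wNorm_of_wDualNormFun_le (φ := innerSL ℝ (A (xp - xh))) (by positivity)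
      (wDualNorm_map_le hLA_pos hLA (xp - xh)) (y - y₀)
  have h4 : Real.sqrt LA * ‖xp - xh‖ * wNorm S (y - y₀) ≤
      LA / (2 * β) * ‖xp - xh‖ ^ 2 + β / 2 * wNorm S (y - y₀) ^ 2 := by
    have hs := Real.sq_sqrt hLA_pos.le
    have h5 : 0 ≤ (Real.sqrt LA * ‖xp - xh‖ - β * wNorm S (y - y₀)) ^ 2 / (2 * β) := by
      positivity
    have h6 : (Real.sqrt LA * ‖xp - xh‖ - β * wNorm S (y - y₀)) ^ 2 / (2 * β) =
        Real.sqrt LA ^ 2 / (2 * β) * ‖xp - xh‖ ^ 2 + β / 2 * wNorm S (y - y₀) ^ 2 -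
          Real.sqrt LA * ‖xp - xh‖ * wNorm S (y - y₀) := by
      field_simp
      ring
    rw [hs] at h6
    linarith
  rw [map_sub, inner_sub_left, inner_sub_right, inner_sub_right] at h3
  have h7 : a + LA / (2 * β) * ‖xp - xh‖ ^ 2 + inner ℝ (A xp) y₀ + LA / (2 * β) * ‖x - xp‖ ^ 2 ≤
      q + LA / (2 * β) * ‖x - xh‖ ^ 2 + inner ℝ (A x) y₀ := by
    refine le_of_mul_le_mul_left ?_ (div_pos hβ hLA_pos)
    have e2 : ∀ w : ℝ, β / LA * (LA / (2 * β) * w) = 1 / 2 * w := fun w => by field_simp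
    simp only [mul_add, e2]
    linarith
  linarith

/-- The Lyapunov estimate: the smoothed primal gap after `k + 1` iterations. -/
theorem IsASGARD.lyapunov {f : E → EReal} {g : F → EReal} {A : E →ₗ[ℝ] F}
    (hf : IsProperClosedConvex f) (hg : IsProperClosedConvex g) {S : F →ₗ[ℝ] G} {p : F → ℝ}
    (hp : IsProxFunction S p 1) {LA : ℝ} (hLA_pos : 0 < LA)
    (hLA : opNormSq S A = ENNReal.ofReal LA) {ydot : F} {x0 : E} {β₁ : ℝ} (hβ₁ : 0 < β₁)
    {xbar xhat : ℕ → E} {ystar : ℕ → F} {τ β : ℕ → ℝ}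
    (halg : IsASGARD f g A p 1 LA ydot x0 β₁ xbar xhat ystar τ β)
    (hdom : ∃ z, fenchelConj g z ≠ ⊤) {xs : E} {fs gs : ℝ} (hfs : f xs = (fs : EReal))
    (hgs : g (A xs) = (gs : EReal)) (k : ℕ) :
    ∀ {y : F} {r a : ℝ}, fenchelConj g y ≤ (r : EReal) → f (xbar (k + 1)) = (a : EReal) →
      a + inner ℝ (A (xbar (k + 1))) y - r - β (k + 1) * bregman p y ydot - (fs + gs) +
        LA / 2 * (τ k ^ 2 / β (k + 1)) *
          ‖xs - (xbar k + (τ k)⁻¹ • (xbar (k + 1) - xbar k))‖ ^ 2 ≤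
      LA / 2 * (τ k ^ 2 / β (k + 1)) * ‖x0 - xs‖ ^ 2 := by
  have hβ := beta_pos halg.tau_zero halg.tau_mem (halg.beta_one ▸ hβ₁) halg.beta_succ
  have hrate := tau_sq_div_beta_succ halg.tau_zero halg.tau_mem halg.tau_root
    (halg.beta_one ▸ hβ₁) halg.beta_succ
  have hFY : ∀ {z : F} {r : ℝ}, fenchelConj g z = (r : EReal) → inner ℝ (A xs) z - r ≤ gs := by
    intro z r hz
    have := fenchelConj_le_coe_iff.1 hz.le (A xs)
    rw [hgs] at this
    exact_mod_cast this
  induction k with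
  | zero =>
    intro y r a hr ha
    obtain ⟨r₀, hr₀⟩ := (halg.dual_step 0).exists_coe hg hdom
    have h := smoothed_lagrangian_step hf hp hLA_pos hLA (hβ 0) (halg.dual_step 0)
      (halg.primal_step 0) hr₀ hr ha hfs.le
    have h1 := hFY hr₀
    have h2 := mul_nonneg (hβ 0).le (hp.bregman_nonneg (ystar 0) ydot)
    rw [halg.xhat_zero] at h
    rw [halg.tau_zero, inv_one, one_smul, add_sub_cancel, norm_sub_rev x0 xs]
    have e : LA / 2 * (1 ^ 2 / β (0 + 1)) = LA / (2 * β (0 + 1)) := by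
      have := (hβ 0).ne'
      field_simp
    rw [e]
    linarith
  | succ k ih =>
    intro y r a hr ha
    obtain ⟨r₀, hr₀⟩ := (halg.dual_step (k + 1)).exists_coe hg hdom
    obtain ⟨b, hb⟩ := (halg.primal_step k).exists_coe hf (div_pos (hβ k) hLA_pos)
    have hτ0 := (halg.tau_mem k).1
    have hτ1 := (halg.tau_mem k).2
    have hτk := tau_pos halg.tau_zero halg.tau_mem k
    -- The induction hypothesis is used at the new dual iterate `ystar (k + 1)`, not at the `y` of
    -- the goal; hence the quantification over `y` inside the induction.
    have hIH := mul_le_mul_of_nonneg_left (ih hr₀.le hb) (by linarith : 0 ≤ 1 - τ (k + 1))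
    have h := smoothed_lagrangian_step hf hp hLA_pos hLA (hβ (k + 1)) (halg.dual_step (k + 1))
      (halg.primal_step (k + 1)) hr₀ hr ha
      (hf.combo_le hb.le hfs.le (by linarith : 0 ≤ 1 - τ (k + 1)) hτ0.le (by ring))
    have e1 : (1 - τ (k + 1)) • xbar (k + 1) + τ (k + 1) • xs - xbar (k + 1 + 1) =
        τ (k + 1) • (xs - (xbar (k + 1) +
          (τ (k + 1))⁻¹ • (xbar (k + 1 + 1) - xbar (k + 1)))) := by
      rw [smul_sub, smul_add, smul_inv_smul₀ hτ0.ne']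
      module
    -- The momentum coefficient is designed for this identity: the distance to `xhat (k + 1)`
    -- becomes `τ (k + 1)` times the distance left over from the previous step.
    have e2 : (1 - τ (k + 1)) • xbar (k + 1) + τ (k + 1) • xs - xhat (k + 1) =
        τ (k + 1) • (xs - (xbar k + (τ k)⁻¹ • (xbar (k + 1) - xbar k))) := by
      have e3 : τ (k + 1) * (1 - τ k) / τ k = τ (k + 1) * (τ k)⁻¹ - τ (k + 1) := by
        field_simp
      rw [halg.xhat_succ, e3]
      module
    rw [e1, e2, norm_smul, norm_smul, mul_pow, mul_pow, Real.norm_of_nonneg hτ0.le, map_add,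
      map_smul, map_smul, inner_add_left, inner_smul_left, inner_smul_left] at h
    simp only [conj_trivial] at h
    have e4 : ∀ w : ℝ, LA / (2 * β (k + 1 + 1)) * (τ (k + 1) ^ 2 * w) =
        (1 - τ (k + 1)) * (LA / 2 * (τ k ^ 2 / β (k + 1)) * w) := by
      intro w
      have e5 : LA / (2 * β (k + 1 + 1)) * (τ (k + 1) ^ 2 * w) =
          LA / 2 * (τ (k + 1) ^ 2 / β (k + 1 + 1)) * w := by
        have := (hβ (k + 1)).ne'
        field_simp
      rw [e5, hrate k]
      ring
    rw [e4, e4] at h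
    rw [show LA / 2 * (τ (k + 1) ^ 2 / β (k + 1 + 1)) =
      (1 - τ (k + 1)) * (LA / 2 * (τ k ^ 2 / β (k + 1))) by rw [hrate k]; ring]
    have h1 := mul_le_mul_of_nonneg_left (hFY hr₀) hτ0.le
    -- Since `(1 - τ)(1 + τ) ≤ 1`, the decrease of `β` is slow enough for the old smoothing term to
    -- be absorbed by the new one.
    have h2 : (1 - τ (k + 1)) * (β (k + 1) * bregman p (ystar (k + 1)) ydot) ≤
        β (k + 1 + 1) * bregman p (ystar (k + 1)) ydot := by
      rw [← mul_assoc]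
      refine mul_le_mul_of_nonneg_right ?_ (hp.bregman_nonneg _ _)
      rw [halg.beta_succ k, inv_one, one_mul, le_div_iff₀ (by positivity)]
      nlinarith [mul_nonneg (hβ k).le (sq_nonneg (τ (k + 1)))]
    linarith

/-- The smoothed primal gap without the nonnegative distance term. -/
theorem IsASGARD.smoothed_gap_le {f : E → EReal} {g : F → EReal} {A : E →ₗ[ℝ] F}
    (hf : IsProperClosedConvex f) (hg : IsProperClosedConvex g) {S : F →ₗ[ℝ] G} {p : F → ℝ}
    (hp : IsProxFunction S p 1) {LA : ℝ} (hLA_pos : 0 < LA)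
    (hLA : opNormSq S A = ENNReal.ofReal LA) {ydot : F} {x0 : E} {β₁ : ℝ} (hβ₁ : 0 < β₁)
    {xbar xhat : ℕ → E} {ystar : ℕ → F} {τ β : ℕ → ℝ}
    (halg : IsASGARD f g A p 1 LA ydot x0 β₁ xbar xhat ystar τ β)
    {xs : E} {fs gs : ℝ} (hfs : f xs = (fs : EReal)) (hgs : g (A xs) = (gs : EReal)) (k : ℕ)
    {y : F} {r a : ℝ} (hr : fenchelConj g y ≤ (r : EReal)) (ha : f (xbar (k + 1)) = (a : EReal)) :
    a + inner ℝ (A (xbar (k + 1))) y - r - β (k + 1) * bregman p y ydot - (fs + gs) ≤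
      LA / 2 * (τ k ^ 2 / β (k + 1)) * ‖x0 - xs‖ ^ 2 := by
  have hb := beta_pos halg.tau_zero halg.tau_mem (halg.beta_one ▸ hβ₁) halg.beta_succ k
  have h := halg.lyapunov hf hg hp hLA_pos hLA hβ₁
    ⟨y, (lt_of_le_of_lt hr (EReal.coe_lt_top r)).ne⟩ hfs hgs k hr ha
  have : 0 ≤ LA / 2 * (τ k ^ 2 / β (k + 1)) *
    ‖xs - (xbar k + (τ k)⁻¹ • (xbar (k + 1) - xbar k))‖ ^ 2 := by positivity
  linarith

end Algorithm

/-! ### The dual objective of the linearly constrained problem. -/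

section LagrangeDuality

variable {E F : Type*} [NormedAddCommGroup E] [InnerProductSpace ℝ E] [FiniteDimensional ℝ E]
  [NormedAddCommGroup F] [InnerProductSpace ℝ F] [FiniteDimensional ℝ F]

/-- Lower bounds on the dual objective of a linearly constrained problem are lower bounds on the
Lagrangian. -/
theorem coe_le_dualObj_indicatorFun_iff {f : E → EReal} {A : E →ₗ[ℝ] F} {c y : F} {m : ℝ} :
    (m : EReal) ≤ dualObj f (indicatorFun {c}) A y ↔
      ∀ x, ((m - inner ℝ (A x - c) y : ℝ) : EReal) ≤ f x := by
  have h1 : (m : EReal) ≤ dualObj f (indicatorFun {c}) A y ↔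
      fenchelConj f (-(LinearMap.adjoint A y)) ≤ ((-m - inner ℝ c y : ℝ) : EReal) := by
    rw [dualObj, fenchelConj_indicatorFun_singleton]
    induction fenchelConj f (-(LinearMap.adjoint A y)) with
    | bot => simp [-EReal.coe_sub]
    | top =>
      rw [EReal.neg_top, EReal.bot_sub]
      exact ⟨fun h => absurd (le_bot_iff.1 h) (EReal.coe_ne_bot _),
        fun h => absurd (top_le_iff.1 h) (EReal.coe_ne_top _)⟩
    | coe a =>
      norm_cast
      constructor <;> intro h <;> linarith
  rw [h1, fenchelConj_le_coe_iff]
  refine forall_congr' fun x => ?_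
  have e : inner ℝ x (-(LinearMap.adjoint A y)) - (-m - inner ℝ c y) =
      m - inner ℝ (A x - c) y := by
    rw [inner_neg_right, LinearMap.adjoint_inner_right, inner_sub_left]
    ring
  rw [e]

/-- Dual solutions are Lagrange multipliers under Slater's condition. -/
theorem lagrangian_ge_of_mem_dualSolutions {f : E → EReal} (hf : IsProperClosedConvex f)
    {A : E →ₗ[ℝ] F} {c : F} (hslater : (intrinsicInterior ℝ (effDom f) ∩ {x | A x = c}).Nonempty)
    {m : ℝ} (hm : ∀ x, A x = c → (m : EReal) ≤ f x) {ys : F}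
    (hys : ys ∈ dualSolutions f (indicatorFun {c}) A) (x : E) :
    ((m - inner ℝ (A x - c) ys : ℝ) : EReal) ≤ f x := by
  obtain ⟨x₁, hx₁, hAx₁⟩ := hslater
  obtain ⟨y₀, hy₀⟩ := exists_lagrange_multiplier hf A hx₁ hAx₁ hm
  -- The multiplier `y₀` shows that the dual value is at least `m`; a dual maximizer does no worse,
  -- so it is a multiplier too.
  exact coe_le_dualObj_indicatorFun_iff.1
    ((coe_le_dualObj_indicatorFun_iff.2 hy₀).trans (hys.2 y₀)) x

end LagrangeDuality

/-! ### From the smoothed gap to feasibility. -/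

section Estimates

variable {E F G : Type*} [NormedAddCommGroup E] [InnerProductSpace ℝ E]
  [NormedAddCommGroup F] [InnerProductSpace ℝ F]
  [NormedAddCommGroup G] [InnerProductSpace ℝ G]

theorem exists_coe_of_mem_primalSolutions {f : E → EReal} {g : F → EReal} {A : E →ₗ[ℝ] F}
    (hf : IsProperClosedConvex f) (hg : IsProperClosedConvex g) {xs : E}
    (hxs : xs ∈ primalSolutions f g A) :
    ∃ fs gs : ℝ, f xs = (fs : EReal) ∧ g (A xs) = (gs : EReal) ∧
      primalValue f g A = ((fs + gs : ℝ) : EReal) := by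
  have hlt : f xs + g (A xs) < ⊤ := hxs.1
  have h1 : f xs ≠ ⊤ := fun h => by
    rw [h, EReal.top_add_of_ne_bot (hg.ne_bot _)] at hlt
    exact lt_irrefl _ hlt
  have h2 : g (A xs) ≠ ⊤ := fun h => by
    rw [h, EReal.add_top_of_ne_bot (hf.ne_bot _)] at hlt
    exact lt_irrefl _ hlt
  obtain ⟨fs, hfs⟩ := hf.exists_coe (show f xs < ⊤ from lt_top_iff_ne_top.2 h1)
  obtain ⟨gs, hgs⟩ := hg.exists_coe (show g (A xs) < ⊤ from lt_top_iff_ne_top.2 h2)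
  refine ⟨fs, gs, hfs, hgs, ?_⟩
  have : primalValue f g A = primalObj f g A xs :=
    le_antisymm (iInf_le _ xs) (le_iInf hxs.2)
  rw [this, primalObj, hfs, hgs, EReal.coe_add]

/-- A quadratic inequality for all step sizes bounds its slope. -/
theorem le_of_forall_linear_le_quadratic {N d β R : ℝ} (hβ : 0 < β) (hN : 0 ≤ N)
    (h : ∀ t, 0 ≤ t → t * N ≤ R + N * d + β * t ^ 2 / 2) :
    N ≤ β * d + Real.sqrt (β ^ 2 * d ^ 2 + 2 * β * R) := by
  -- The maximizer of `t * N - β * t ^ 2 / 2`.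
  have h1 := h (N / β) (by positivity)
  have h2 : N ^ 2 ≤ 2 * β * R + 2 * β * (N * d) := by
    have e1 : N / β * N = N ^ 2 / β := by ring
    have e2 : β * (N / β) ^ 2 / 2 = N ^ 2 / β / 2 := by field_simp
    rw [e1, e2] at h1
    have h3 : N ^ 2 / β ≤ 2 * (R + N * d) := by linarith
    rw [div_le_iff₀ hβ] at h3
    linarith
  have h3 : N - β * d ≤ Real.sqrt (β ^ 2 * d ^ 2 + 2 * β * R) := by
    apply Real.le_sqrt_of_sq_le
    nlinarith
  linarith

/-- The feasibility estimate from the smoothed gap. -/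
theorem wDualNorm_le_of_smoothed_gap {S : F →ₗ[ℝ] G} {p : F → ℝ} (hp : IsProxFunction S p 1)
    {u ys ydot : F} (hu : wDualNorm S u ≠ ⊤) {β R : ℝ} (hβ : 0 < β) (hR : 0 ≤ R)
    (h : ∀ y, inner ℝ u (y - ys) - β * bregman p y ydot ≤ R) :
    wDualNorm S u ≤ ENNReal.ofReal (β * wNorm S (ys - ydot) +
      Real.sqrt (β ^ 2 * wNorm S (ys - ydot) ^ 2 + 2 * β * R)) := by
  set N := (wDualNorm S u).toReal
  set d := wNorm S (ys - ydot)
  have hN : 0 ≤ N := ENNReal.toReal_nonneg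
  have hd : 0 ≤ d := norm_nonneg _
  rw [← ENNReal.ofReal_toReal hu]
  refine ENNReal.ofReal_le_ofReal (le_of_forall_linear_le_quadratic hβ hN fun t ht => ?_)
  have h1 : ∀ v, wNorm S v ≤ 1 → t * inner ℝ u v ≤ R + N * d + β * t ^ 2 / 2 := by
    intro v hv
    -- A step of length at most `t` from the prox-center costs at most `β * t ^ 2 / 2` in the
    -- Bregman term; the supremum over `v` then produces `t * N`.
    have h2 := h (ydot + t • v)
    have h3 := hp.bregman_le (ydot + t • v) ydot
    have h4 : wNorm S (ydot + t • v - ydot) ≤ t := by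
      rw [add_sub_cancel_left]
      simp only [wNorm, map_smul, norm_smul, Real.norm_of_nonneg ht]
      exact mul_le_of_le_one_right ht hv
    have h5 : wNorm S (ydot + t • v - ydot) ^ 2 ≤ t ^ 2 :=
      pow_le_pow_left₀ (norm_nonneg _) h4 2
    have h6 := inner_le_wDualNorm_mul hu (ys - ydot)
    have h7 : β * bregman p (ydot + t • v) ydot ≤ β * (1 / 2 * t ^ 2) :=
      mul_le_mul_of_nonneg_left (by linarith) hβ.le
    have e : ydot + t • v - ys = t • v - (ys - ydot) := by abel
    rw [e, inner_sub_right, inner_smul_right] at h2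
    linarith
  rcases eq_or_lt_of_le ht with h0 | h0
  · rw [← h0, zero_mul]
    positivity
  · rw [← le_div_iff₀' h0]
    refine ENNReal.toReal_le_of_le_ofReal (by positivity) (wDualNorm_le_ofReal fun v hv => ?_)
    rw [le_div_iff₀' h0]
    exact h1 v hv

end Estimates

theorem mainTheorem1 {E F G : Type*}
    [NormedAddCommGroup E] [InnerProductSpace ℝ E] [FiniteDimensional ℝ E]
    [NormedAddCommGroup F] [InnerProductSpace ℝ F] [FiniteDimensional ℝ F]
    [NormedAddCommGroup G] [InnerProductSpace ℝ G] [FiniteDimensional ℝ G]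
    (f : E → EReal) (g : F → EReal) (A : E →ₗ[ℝ] F)
    (hf : IsProperClosedConvex f) (hg : IsProperClosedConvex g)
    (S : F →ₗ[ℝ] G) (p : F → ℝ) (hp : IsProxFunction S p 1)
    (LA : ℝ) (hLA_pos : 0 < LA) (hLA : opNormSq S A = ENNReal.ofReal LA)
    (ydot : F) (x0 : E) (β₁ : ℝ) (hβ₁ : 0 < β₁)
    (xbar xhat : ℕ → E) (ystar : ℕ → F) (τ β : ℕ → ℝ)
    (halg : IsASGARD f g A p 1 LA ydot x0 β₁ xbar xhat ystar τ β) :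
    (effDom g = Set.univ →
      ∀ xs ∈ primalSolutions f g A, ∀ k : ℕ, 1 ≤ k → ∀ y ∈ subdiff g (A (xbar k)),
        primalObj f g A (xbar k) - primalValue f g A ≤
          ((LA / (2 * β₁ * k) * ‖x0 - xs‖ ^ 2 + 2 * β₁ / (k + 1) * bregman p y ydot : ℝ) :
            EReal)) ∧
    (∀ c : F, g = indicatorFun {c} →
      (intrinsicInterior ℝ (effDom f) ∩ {x | A x = c}).Nonempty →
      ∀ xs ∈ primalSolutions f g A, ∀ ys ∈ dualSolutions f g A, ∀ k : ℕ, 1 ≤ k →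
        ((-(wNorm S ys * (wDualNorm S (A (xbar k) - c)).toReal) : ℝ) : EReal) ≤
            f (xbar k) - primalValue f g A ∧
        f (xbar k) - primalValue f g A ≤
          ((1 / k * (LA / (2 * β₁)) * ‖x0 - xs‖ ^ 2 +
            wNorm S ys * (wDualNorm S (A (xbar k) - c)).toReal +
            2 * β₁ / (k + 1) * bregman p ys ydot : ℝ) : EReal) ∧
        wDualNorm S (A (xbar k) - c) ≤
          ENNReal.ofReal (2 * β₁ / (k + 1) *
            (wNorm S (ys - ydot) +
              Real.sqrt (wNorm S (ys - ydot) ^ 2 + LA / β₁ ^ 2 * ‖x0 - xs‖ ^ 2)))) := by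
  have hβ1 : 0 < β 1 := halg.beta_one ▸ hβ₁
  have hβ := beta_pos halg.tau_zero halg.tau_mem hβ1 halg.beta_succ
  have hβle := beta_le halg.tau_zero halg.tau_mem halg.tau_root hβ1 halg.beta_succ
  have hrate := tau_sq_div_beta_le halg.tau_zero halg.tau_mem halg.tau_root hβ1 halg.beta_succ
  rw [halg.beta_one] at hβle hrate
  have hR : ∀ (k : ℕ) (xs : E), LA / 2 * (τ k ^ 2 / β (k + 1)) * ‖x0 - xs‖ ^ 2 ≤
      LA / (2 * β₁ * (k + 1)) * ‖x0 - xs‖ ^ 2 := by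
    intro k xs
    calc _ ≤ LA / 2 * (1 / (β₁ * (k + 1))) * ‖x0 - xs‖ ^ 2 := by gcongr LA / 2 * ?_ * _; exact hrate k
      _ = _ := by field_simp
  have hB : ∀ (k : ℕ) (y : F), β (k + 1) * bregman p y ydot ≤
      2 * β₁ / ((k : ℝ) + 1 + 1) * bregman p y ydot := fun k y => by
    refine mul_le_mul_of_nonneg_right ?_ (hp.bregman_nonneg _ _)
    rw [add_assoc, one_add_one_eq_two]
    exact hβle k
  refine ⟨fun _ xs hxs k hk y hy => ?_, ?_⟩
  -- The iterate `xbar (k + 1)` is paired with `τ k` and `β (k + 1)`, so `k` is shifted by one from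
  -- here on.
  · obtain ⟨k, rfl⟩ := Nat.exists_eq_add_of_le' hk
    obtain ⟨fs, gs, hfs, hgs, hP⟩ := exists_coe_of_mem_primalSolutions hf hg hxs
    obtain ⟨a, ha⟩ := (halg.primal_step k).exists_coe hf (div_pos (hβ k) hLA_pos)
    obtain ⟨b, hb⟩ := hg.exists_coe hy.1
    have h := halg.smoothed_gap_le hf hg hp hLA_pos hLA hβ₁ hfs hgs k
      (fenchelConj_of_mem_subdiff hb hy) ha
    rw [primalObj, hP, ha, hb]
    norm_cast
    push_cast
    linarith [hR k xs, hB k y]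
  · rintro c rfl hslater xs hxs ys hys k hk
    obtain ⟨k, rfl⟩ := Nat.exists_eq_add_of_le' hk
    obtain ⟨fs, gs, hfs, hgs, hP⟩ := exists_coe_of_mem_primalSolutions hf hg hxs
    obtain ⟨a, ha⟩ := (halg.primal_step k).exists_coe hf (div_pos (hβ k) hLA_pos)
    have hAxs : A xs = c := by
      by_contra hne
      simp [indicatorFun, hne] at hgs
    obtain rfl : gs = 0 := by
      simp only [indicatorFun, hAxs, mem_singleton_iff, if_true] at hgs
      exact_mod_cast hgs.symm
    rw [add_zero] at hP
    have hm : ∀ x, A x = c → (fs : EReal) ≤ f x := by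
      intro x hx
      have := hxs.2 x
      simpa [primalObj, indicatorFun, hx, hAxs, hfs] using this
    have hlag := lagrangian_ge_of_mem_dualSolutions hf hslater hm hys (xbar (k + 1))
    rw [ha, EReal.coe_le_coe_iff] at hlag
    have hgap : ∀ y, a + inner ℝ (A (xbar (k + 1)) - c) y - β (k + 1) * bregman p y ydot - fs ≤
        LA / 2 * (τ k ^ 2 / β (k + 1)) * ‖x0 - xs‖ ^ 2 := by
      intro y
      have h := halg.smoothed_gap_le hf hg hp hLA_pos hLA hβ₁ hfs hgs k
        (fenchelConj_indicatorFun_singleton c y).le ha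
      rw [inner_sub_left]
      linarith
    set u := A (xbar (k + 1)) - c with hu_def
    have hu : wDualNorm S u ≠ ⊤ := by
      rw [hu_def, ← hAxs, ← map_sub]
      exact ne_top_of_le_ne_top ENNReal.ofReal_ne_top (wDualNorm_map_le hLA_pos hLA _)
    rw [hP, ha]
    refine ⟨?_, ?_, ?_⟩
    · norm_cast
      have h := inner_le_wDualNorm_mul hu ys
      linarith
    · norm_cast
      push_cast
      -- The gap at `ys` leaves `-⟨u, ys⟩` on the right, which the dual norm bounds through `-ys`.
      have h := inner_le_wDualNorm_mul hu (-ys)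
      have e : wNorm S (-ys) = wNorm S ys := by simp [wNorm]
      have e' : 1 / ((k : ℝ) + 1) * (LA / (2 * β₁)) = LA / (2 * β₁ * (k + 1)) := by
        field_simp
      rw [inner_neg_right, e] at h
      rw [e']
      linarith [hR k xs, hB k ys, hgap ys]
    · have hk1 := hβ k
      refine (wDualNorm_le_of_smoothed_gap (ys := ys) (ydot := ydot) hp hu (hβ k)
        (R := LA / 2 * (τ k ^ 2 / β (k + 1)) * ‖x0 - xs‖ ^ 2) (by positivity)
        fun y => ?_).trans (ENNReal.ofReal_le_ofReal ?_)
      -- Adding the Lagrangian lower bound `hlag` eliminates the objective and leaves only `⟨u, y -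
      -- ys⟩`.
      · have h := hgap y
        rw [inner_sub_right]
        linarith
      · set d := wNorm S (ys - ydot)
        have hd : 0 ≤ d := norm_nonneg _
        have hτ := tau_le_two_div halg.tau_zero halg.tau_mem halg.tau_root k
        have hτ0 := tau_pos halg.tau_zero halg.tau_mem k
        push_cast
        rw [add_assoc (k : ℝ) 1 1, one_add_one_eq_two]
        have hq : 0 ≤ 2 * β₁ / ((k : ℝ) + 2) := by positivity
        rw [mul_add, ← Real.sqrt_sq hq, ← Real.sqrt_mul (sq_nonneg _), Real.sqrt_sq hq]
        refine add_le_add (mul_le_mul_of_nonneg_right (hβle k) hd) (Real.sqrt_le_sqrt ?_)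
        rw [mul_add]
        -- Here `β (k + 1)` cancels, so the decay of this term rests on the upper bound `hτ` for `τ
        -- k`.
        have e1 : 2 * β (k + 1) * (LA / 2 * (τ k ^ 2 / β (k + 1)) * ‖x0 - xs‖ ^ 2) =
            τ k ^ 2 * (LA * ‖x0 - xs‖ ^ 2) := by field_simp
        have e2 : (2 * β₁ / ((k : ℝ) + 2)) ^ 2 * (LA / β₁ ^ 2 * ‖x0 - xs‖ ^ 2) =
            (2 / ((k : ℝ) + 2)) ^ 2 * (LA * ‖x0 - xs‖ ^ 2) := by field_simp
        rw [e1, e2]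
        have := hβle k
        gcongr
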